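/- Let $r\ge 1$ and let $e_1,\dots,e_{r+1}$ be the standard basis of $\mathbb{R}^{r+1}$. Let $\alpha_i=e_i-e_{i+1}$ ($1\le i\le r$) be the simple roots of type $A_r$ (the root system of $\mathfrak{sl}_{r+1}(\mathbb{C})$), $\Phi^+=\{\alpha_i+\alpha_{i+1}+\cdots+\alpha_j : 1\le i\le j\le r\}$ the positive roots, $\tilde\alpha=\alpha_1+\cdots+\alpha_r$ the highest root, $\rho=\frac12\sum_{\alpha\in\Phi^+}\alpha$, and $W$ the Weyl group, generated by the reflections $s_i$ through the hyperplanes orthogonal to $\alpha_i$, $1\le i\le r$. Let $\wp(\xi)$ be Kostant's partition function, that is, the number of ways to write $\xi$ as a linear combination of positive roots with nonnegative integer coefficients. For weights $\lambda,\mu$, the Weyl alternation set is $$\mathcal{A}_r(\lambda,\mu)=\{\sigma\in W : \wp(\sigma(\lambda+\rho)-\mu-\rho)>0\}.$$ Let $F_0=0$, $F_1=1$ and $F_n=F_{n-1}+F_{n-2}$ for $n\ge 2$ be the Fibonacci numbers. Fix $1\le i\le r$. 1. If $i=1$ or $i=r$, then $|\mathcal{A}_r(\tilde\alpha,-\alpha_i)|=F_{r+1}$.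 2. If $r>2$ and $2\le i\le r-1$, then $|\mathcal{A}_r(\tilde\alpha,-\alpha_i)|=F_r+F_{i-1}F_{r-i-1}+F_{i-2}F_{r-i}$. -/

import Mathlib

/-! The root system of type `A_r` (the root system of `𝔰𝔩_{r+1}(ℂ)`), its Weyl group, Kostant's
partition function and Weyl alternation sets. All indices start at `1`, as is customary for roots. -/

namespace TypeA

noncomputable section

/-- The Euclidean space `ℝ^{r+1}` that contains the root system of type `A_r`. -/
abbrev Space (r : ℕ) : Type := EuclideanSpace ℝ (Fin (r + 1))

/-- The standard basis vector `e_i` of `ℝ^{r+1}`, for `1 ≤ i ≤ r + 1`. The entry with index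
`k : Fin (r + 1)` is the `(k + 1)`-st entry of a vector. -/
def e (r i : ℕ) : Space r :=
  WithLp.toLp 2 (fun k : Fin (r + 1) => if (k : ℕ) + 1 = i then (1 : ℝ) else 0)

/-- The simple root `α_i = e_i - e_{i+1}`, for `1 ≤ i ≤ r`. -/
def simpleRoot (r i : ℕ) : Space r := e r i - e r (i + 1)

/-- The positive root `α_{i,j} = α_i + α_{i+1} + ⋯ + α_j`, for `1 ≤ i ≤ j ≤ r`. -/
def posRoot (r i j : ℕ) : Space r := ∑ k ∈ Finset.Icc i j, simpleRoot r k

open Classical in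
/-- The set `Φ⁺ = {α_{i,j} : 1 ≤ i ≤ j ≤ r}` of positive roots. -/
def positiveRoots (r : ℕ) : Finset (Space r) :=
  ((Finset.Icc 1 r ×ˢ Finset.Icc 1 r).filter (fun p => p.1 ≤ p.2)).image
    (fun p => posRoot r p.1 p.2)

/-- The highest root `α̃ = α_1 + ⋯ + α_r`. -/
def highestRoot (r : ℕ) : Space r := ∑ k ∈ Finset.Icc 1 r, simpleRoot r k

/-- `ρ`, half the sum of the positive roots. -/
def rho (r : ℕ) : Space r := (1 / 2 : ℝ) • ∑ β ∈ positiveRoots r, β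

/-- The simple reflection `s_i`: the reflection through the hyperplane orthogonal to `α_i`. -/
def simpleReflection (r i : ℕ) : Space r ≃ₗᵢ[ℝ] Space r :=
  (Submodule.span ℝ {simpleRoot r i})ᗮ.reflection

theorem simpleReflection_apply (r i : ℕ) (v : Space r) :
    simpleReflection r i v = v - (2 * (inner ℝ (simpleRoot r i) v /
      inner ℝ (simpleRoot r i) (simpleRoot r i))) • simpleRoot r i := by
  rw [simpleReflection, Submodule.reflection_orthogonal_apply, Submodule.reflection_singleton_apply,
    real_inner_self_eq_norm_sq]
  simp [mul_smul, two_smul]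

/-- The Weyl group `W` of type `A_r`, generated by `s_1, …, s_r`. -/
def weylGroup (r : ℕ) : Subgroup (Space r ≃ₗᵢ[ℝ] Space r) :=
  Subgroup.closure (simpleReflection r '' Set.Icc 1 r)

/-- The ways to write `ξ` as a linear combination of the positive roots with coefficients in
`ℤ_{≥ 0}`, each given by its family of coefficients. -/
def partitions (r : ℕ) (ξ : Space r) : Set (positiveRoots r → ℕ) :=
  {c | ∑ β : positiveRoots r, c β • (β : Space r) = ξ}

/-- Minus the sum of `k x_k`; it takes the value `j - i + 1` at `α_{i,j}`. -/
def height (r : ℕ) (x : Space r) : ℝ := -∑ k : Fin (r + 1), (k : ℝ) * x k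

theorem height_add (r : ℕ) (x y : Space r) : height r (x + y) = height r x + height r y := by
  simp [height, mul_add, Finset.sum_add_distrib]; ring

/-- `height` as an additive homomorphism. -/
def heightHom (r : ℕ) : Space r →+ ℝ := AddMonoidHom.mk' (height r) (height_add r)

theorem height_e (r i : ℕ) (h1 : 1 ≤ i) (h2 : i ≤ r + 1) : heightHom r (e r i) = -(i - 1) := by
  have key : ∀ k : Fin (r + 1), ((k : ℕ) + 1 = i) ↔ k = ⟨i - 1, by omega⟩ := by
    intro k; rw [Fin.ext_iff]; simp only; omega
  simp [heightHom, height, e, key, Nat.cast_sub h1]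

theorem height_simpleRoot (r i : ℕ) (h1 : 1 ≤ i) (h2 : i ≤ r) :
    heightHom r (simpleRoot r i) = 1 := by
  rw [simpleRoot, map_sub, height_e r i h1 (by omega), height_e r (i + 1) (by omega) (by omega)]
  push_cast; ring

theorem one_le_height (r : ℕ) (β : Space r) (hβ : β ∈ positiveRoots r) : 1 ≤ heightHom r β := by
  simp only [positiveRoots, Finset.mem_image, Finset.mem_filter, Finset.mem_product,
    Finset.mem_Icc] at hβ
  obtain ⟨⟨i, j⟩, ⟨⟨⟨hi, _⟩, ⟨_, hj⟩⟩, hij⟩, rfl⟩ := hβ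
  simp only at hi hj hij ⊢
  rw [posRoot, map_sum, Finset.sum_congr rfl (fun k hk => height_simpleRoot r k
    (by have := Finset.mem_Icc.1 hk; omega) (by have := Finset.mem_Icc.1 hk; omega))]
  simp only [Finset.sum_const, Nat.card_Icc, nsmul_eq_mul, mul_one]
  exact_mod_cast (by omega : 1 ≤ j + 1 - i)

/-- There are only finitely many ways, so that the number of ways below is a true count. -/
theorem partitions_finite (r : ℕ) (ξ : Space r) : (partitions r ξ).Finite := by
  refine (Set.finite_Iic (fun _ : positiveRoots r => ⌊heightHom r ξ⌋₊)).subset ?_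
  intro c hc β
  have h : ∑ γ : positiveRoots r, (c γ : ℝ) * heightHom r γ = heightHom r ξ := by
    rw [← (show _ = ξ from hc), map_sum]
    exact Finset.sum_congr rfl fun γ _ => by rw [map_nsmul, nsmul_eq_mul]
  apply Nat.le_floor
  rw [← h]
  have h1 := one_le_height r β β.2
  calc (c β : ℝ) ≤ (c β : ℝ) * heightHom r β := le_mul_of_one_le_right (Nat.cast_nonneg _) h1
    _ ≤ _ := Finset.single_le_sum (f := fun γ : positiveRoots r => (c γ : ℝ) * heightHom r γ)
      (fun γ _ => mul_nonneg (Nat.cast_nonneg _) (by linarith [one_le_height r γ γ.2]))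
      (Finset.mem_univ β)

/-- Kostant's partition function `℘`: the number of ways to write `ξ` as a linear combination of
the positive roots with nonnegative integer coefficients. -/
def kostantPartition (r : ℕ) (ξ : Space r) : ℕ := (partitions r ξ).ncard

/-- The Weyl alternation set `𝒜_r(lam, μ) = {σ ∈ W : ℘(σ(lam + ρ) - μ - ρ) > 0}`. -/
def weylAlternationSet (r : ℕ) (lam μ : Space r) : Set (weylGroup r) :=
  {σ | 0 < kostantPartition r
    ((σ : Space r ≃ₗᵢ[ℝ] Space r) (lam + rho r) - μ - rho r)}

end

end TypeA

/-! The Weyl group is the symmetric group permuting coordinates, and `℘(ξ) > 0` exactly when the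
coefficients of `ξ` in the simple roots, i.e. its partial coordinate sums, are natural numbers and
the total is `0` (`kostantPartition_pos_iff`). Writing `σ` as the inverse of a permutation `τ`, the
`m`-th partial sum depends only on the set `P` of the first `m` values of `τ`. Call `E(P) = ∑ P - (0
+ ⋯ + (#P - 1))` the excess of `P`; it is `0` exactly for an initial interval. Membership of `σ`
becomes `E(P) + [r ∈ P] ≤ [0 ∈ P] + [#P = i]` for all these `P` (`alternation_iff`).

So the permutations to count are paths of growing sets whose excess stays at most `1`, or `2` at
size `i`. Away from size `i`, an interval either grows by its next value, or skips one value and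
must insert it immediately afterwards: this is the Fibonacci recursion. The value `r` costs one unit
at the end, and size `i` gives one unit back, which allows a few extra detours. Counting these gives
the formulas in both cases (`numCompletions_first_or_last`, `numCompletions_interior`). -/

namespace TypeA

open Finset

/-! ### Counting permutations by their initial segments -/

/-- The lists of `k` distinct numbers below `n`, all outside `P`, such that every set obtained by
adding the entries of a nonempty initial segment to `P` satisfies `good`. -/
def completions (good : Finset ℕ → Prop) [DecidablePred good] (n : ℕ) :
    ℕ → Finset ℕ → Finset (List ℕ)
  | 0, _ => {[]}
  | k + 1, P => ((range n \ P).filter (fun x => good (insert x P))).biUnion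
      (fun x => (completions good n k (insert x P)).image (List.cons x))

theorem mem_completions (good : Finset ℕ → Prop) [DecidablePred good] (n k : ℕ)
    (P : Finset ℕ) (l : List ℕ) :
    l ∈ completions good n k P ↔ l.length = k ∧ l.Nodup ∧ (∀ x ∈ l, x < n ∧ x ∉ P) ∧
      ∀ m, m < k → good (P ∪ (l.take (m + 1)).toFinset) := by
  induction k generalizing P l with
  | zero =>
    simp only [completions, mem_singleton, List.length_eq_zero_iff]
    constructor
    · rintro rfl; simp
    · exact fun h => h.1
  | succ k ih =>
    have union_cons (x : ℕ) (t : List ℕ) :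
        P ∪ (x :: t).toFinset = insert x P ∪ t.toFinset := by
      ext y; simp
    cases l with
    | nil => simp [completions]
    | cons x t =>
      simp only [completions, mem_biUnion, mem_filter, mem_sdiff, mem_range, mem_image,
        List.cons.injEq, List.length_cons, List.nodup_cons, List.mem_cons, forall_eq_or_imp,
        List.take_succ_cons, union_cons]
      constructor
      · rintro ⟨x, ⟨⟨hx, hxP⟩, hg⟩, t, ht, rfl, rfl⟩
        obtain ⟨h1, h2, h3, h4⟩ := (ih _ _).1 ht
        refine ⟨by omega, ⟨fun hxt => (h3 x hxt).2 (mem_insert_self _ _), h2⟩,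
          ⟨⟨hx, hxP⟩, fun y hy => ⟨(h3 y hy).1, fun hP => (h3 y hy).2 (mem_insert_of_mem hP)⟩⟩, ?_⟩
        intro m hm
        cases m with
        | zero => simpa using hg
        | succ m => exact h4 m (by omega)
      · rintro ⟨h1, ⟨h2, h2'⟩, ⟨h3, h3'⟩, h4⟩
        refine ⟨x, ⟨h3, by simpa using h4 0 (by omega)⟩, t, (ih _ _).2
          ⟨by omega, h2', fun y hy => ⟨(h3' y hy).1, ?_⟩, fun m hm => h4 (m + 1) (by omega)⟩, rfl, rfl⟩
        rw [mem_insert, not_or]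
        exact ⟨fun h => h2 (h ▸ hy), (h3' y hy).2⟩

theorem card_completions_succ (good : Finset ℕ → Prop) [DecidablePred good] (n k : ℕ)
    (P S : Finset ℕ) (hS : ∀ x, x ∈ S ↔ (x < n ∧ x ∉ P) ∧ good (insert x P)) :
    (completions good n (k + 1) P).card = ∑ x ∈ S, (completions good n k (insert x P)).card := by
  have : (range n \ P).filter (fun x => good (insert x P)) = S := by
    ext x; simp [hS]
  rw [completions, this, card_biUnion]
  · exact sum_congr rfl fun x _ => card_image_of_injective _ (List.cons_injective)
  · intro x _ y _ hxy
    rw [Function.onFun, Finset.disjoint_left]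
    simp only [mem_image, not_exists, not_and]
    rintro _ ⟨t, _, rfl⟩ u _ h
    exact hxy (List.cons.inj h).1.symm

/-- Permutations all of whose initial segments have a good set of values, counted by lists. -/
theorem ncard_perm_eq_card_completions (good : Finset ℕ → Prop) [DecidablePred good] (n : ℕ) :
    {τ : Equiv.Perm (Fin n) | ∀ m < n,
      good ((List.ofFn fun k => (τ k : ℕ)).take (m + 1)).toFinset}.ncard
      = (completions good n n ∅).card := by
  rw [← Set.ncard_coe_finset]
  refine Set.ncard_congr (fun τ _ => List.ofFn fun k => (τ k : ℕ)) ?_ ?_ ?_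
  · intro τ hτ
    rw [mem_coe, mem_completions]
    refine ⟨by simp, List.nodup_ofFn.2 (Fin.val_injective.comp τ.injective), ?_, ?_⟩
    · intro x hx
      obtain ⟨k, rfl⟩ := List.mem_ofFn.1 hx
      simp
    · simpa using hτ
  · intro τ τ' _ _ h
    ext k
    exact congrFun (List.ofFn_injective h) k
  · intro l hl
    obtain ⟨h1, h2, h3, h4⟩ := (mem_completions _ _ _ _ _).1 (mem_coe.1 hl)
    subst h1
    let f : Fin l.length → Fin l.length := fun k => ⟨l.get k, (h3 _ (List.get_mem l k)).1⟩
    have hf : Function.Injective f := fun a b hab =>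
      List.nodup_iff_injective_get.1 h2 (congrArg Fin.val hab)
    have hof : (List.ofFn fun k => (Equiv.ofBijective f (Finite.injective_iff_bijective.1 hf) k : ℕ))
        = l := by
      simp [f]
    refine ⟨Equiv.ofBijective f (Finite.injective_iff_bijective.1 hf), ?_, hof⟩
    intro m hm
    rw [hof]
    simpa using h4 m hm

/-! ### Good prefixes and their one-step recursion -/

/-- The condition that a set `P` of values at the first `#P` places imposes on a permutation that
lies, after inversion, in the Weyl alternation set of the highest root and `-α_i`. -/
def GoodPrefix (r i : ℕ) (P : Finset ℕ) : Prop :=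
  ∑ v ∈ P, v + (if r ∈ P then 1 else 0) ≤
    ∑ k ∈ range P.card, k + (if 0 ∈ P then 1 else 0) + (if P.card = i then 1 else 0)

instance (r i : ℕ) : DecidablePred (GoodPrefix r i) := fun _ => by
  unfold GoodPrefix; infer_instance

/-- The number of ways to complete `P` to a permutation of `range (r + 1)` with good prefixes. -/
def numCompletions (r i : ℕ) (P : Finset ℕ) : ℕ :=
  (completions (GoodPrefix r i) (r + 1) (r + 1 - P.card) P).card

theorem numCompletions_range_self (r i : ℕ) : numCompletions r i (range (r + 1)) = 1 := by
  simp [numCompletions, completions]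

/-- The condition on the next value `x` is spelled out with the sum over `P` kept separate, so that
for the concrete sets below it becomes linear arithmetic. -/
theorem numCompletions_eq_sum (r i : ℕ) (P S : Finset ℕ) (hP : P.card ≤ r)
    (hS : ∀ x, x ∈ S ↔ (x ≤ r ∧ x ∉ P) ∧
      ∑ v ∈ P, v + x + (if r = x ∨ r ∈ P then 1 else 0) ≤
        ∑ k ∈ range P.card, k + P.card + (if 0 = x ∨ 0 ∈ P then 1 else 0)
          + (if P.card + 1 = i then 1 else 0)) :
    numCompletions r i P = ∑ x ∈ S, numCompletions r i (insert x P) := by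
  obtain ⟨k, hk⟩ := Nat.exists_eq_add_of_le hP
  rw [numCompletions, show r + 1 - P.card = k + 1 by omega,
    card_completions_succ (good := GoodPrefix r i) (S := S)]
  · refine sum_congr rfl fun x hx => ?_
    rw [numCompletions, card_insert_of_notMem ((hS x).1 hx).1.2]
    congr; omega
  · intro x
    rw [hS x, Nat.lt_succ_iff]
    refine and_congr_right fun hx => ?_
    rw [GoodPrefix, card_insert_of_notMem hx.2, sum_insert hx.2, sum_range_succ, add_comm x]
    simp only [mem_insert]

/-! ### Possible moves between intervals and intervals with a gap -/

section Steps

variable {r i m : ℕ}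

theorem sum_range_step (m : ℕ) : ∑ k ∈ range (m + 1), k = ∑ k ∈ range m, k + m :=
  sum_range_succ _ _

theorem numCompletions_range_top (hr : 1 ≤ r) : numCompletions r i (range r) = 1 := by
  rw [numCompletions_eq_sum r i (range r) {r}, sum_singleton, ← range_add_one,
    numCompletions_range_self]
  · simp
  · intro x
    simp only [mem_singleton, mem_range, card_range]
    split_ifs <;> omega

/-- Since `0` is already used, the next set may have excess `1`: at most one value is skipped. -/
theorem numCompletions_range (hm : 1 ≤ m) (hmr : m + 1 < r) (hi : m + 1 ≠ i) :
    numCompletions r i (range m)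
      = numCompletions r i (range (m + 1)) + numCompletions r i (insert (m + 1) (range m)) := by
  rw [numCompletions_eq_sum r i (range m) {m, m + 1}, sum_pair (by omega), ← range_add_one]
  · simp; omega
  · intro x
    simp only [mem_singleton, mem_range, card_range, mem_insert]
    split_ifs <;> omega

theorem numCompletions_range_pred_top (hm : 1 ≤ m) (hmr : m + 1 = r) (hi : m + 1 ≠ i) :
    numCompletions r i (range m) = numCompletions r i (range (m + 1)) := by
  rw [numCompletions_eq_sum r i (range m) {m}, sum_singleton, ← range_add_one]
  · simp; omega
  · intro x
    simp only [mem_singleton, mem_range, card_range]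
    split_ifs <;> omega

/-- At place `i = r` the bonus pays for using the value `r` early. -/
theorem numCompletions_range_pred_top_of_eq (hm : 1 ≤ m) (hmr : m + 1 = r) (hi : m + 1 = i) :
    numCompletions r i (range m)
      = numCompletions r i (range (m + 1)) + numCompletions r i (insert (m + 1) (range m)) := by
  rw [numCompletions_eq_sum r i (range m) {m, m + 1}, sum_pair (by omega), ← range_add_one]
  · simp; omega
  · intro x
    simp only [mem_singleton, mem_range, card_range, mem_insert]
    split_ifs <;> omega

/-- At place `i` the allowance is `2`, so two values may be skipped. -/
theorem numCompletions_range_special (hm : 1 ≤ m) (hmr : m + 2 < r) (hi : m + 1 = i) :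
    numCompletions r i (range m)
      = numCompletions r i (range (m + 1)) + (numCompletions r i (insert (m + 1) (range m))
        + numCompletions r i (insert (m + 2) (range m))) := by
  rw [numCompletions_eq_sum r i (range m) {m, m + 1, m + 2}, sum_insert (by simp),
    sum_pair (by omega), ← range_add_one]
  · simp; omega
  · intro x
    simp only [mem_singleton, mem_range, card_range, mem_insert]
    split_ifs <;> omega

theorem numCompletions_range_special_top (hm : 1 ≤ m) (hmr : m + 2 = r) (hi : m + 1 = i) :
    numCompletions r i (range m)
      = numCompletions r i (range (m + 1)) + numCompletions r i (insert (m + 1) (range m)) := by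
  rw [numCompletions_eq_sum r i (range m) {m, m + 1}, sum_pair (by omega), ← range_add_one]
  · simp; omega
  · intro x
    simp only [mem_singleton, mem_range, card_range, mem_insert]
    split_ifs <;> omega

theorem numCompletions_range_zero (hr : 1 ≤ r) (hi : i ≠ 1 ∨ r = 1) :
    numCompletions r i (range 0) = numCompletions r i (range 1) := by
  rw [numCompletions_eq_sum r i (range 0) {0}, sum_singleton, ← range_add_one]
  · simp
  · intro x
    simp only [mem_singleton, mem_range, card_range, sum_range_zero]
    split_ifs <;> omega

/-- Without `0` in the set there is no allowance except the bonus at size `i = 1`, which lets a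
permutation start with `1`. -/
theorem numCompletions_range_zero_one (hr : 1 < r) :
    numCompletions r 1 (range 0)
      = numCompletions r 1 (range 1) + numCompletions r 1 (insert 1 (range 0)) := by
  rw [numCompletions_eq_sum r 1 (range 0) {0, 1}, sum_pair (by omega), ← range_add_one]
  · simp
  · intro x
    simp only [mem_singleton, mem_range, card_range, sum_range_zero, mem_insert]
    split_ifs <;> omega

theorem insert_insert_range (m : ℕ) : insert m (insert (m + 1) (range m)) = range (m + 2) := by
  ext; simp; omega

/-- Any value other than the missing `m` would raise the excess to at least `2`. This is too much
away from place `i`; if `m + 2 = i = r`, the penalty for `r` uses up the bonus. -/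
theorem numCompletions_gap (hmr : m + 1 ≤ r) (hi : m + 2 ≠ i ∨ i = r) :
    numCompletions r i (insert (m + 1) (range m)) = numCompletions r i (range (m + 2)) := by
  have hc : (insert (m + 1) (range m)).card = m + 1 := by
    rw [card_insert_of_notMem (by simp), card_range]
  rw [numCompletions_eq_sum r i _ {m}, sum_singleton, insert_insert_range]
  · omega
  · intro x
    rw [hc, sum_range_step, sum_insert (by simp)]
    simp only [mem_singleton, mem_range, mem_insert]
    split_ifs <;> omega

theorem numCompletions_gap_special (hm : 1 ≤ m) (hmr : m + 2 < r) (hi : m + 2 = i) :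
    numCompletions r i (insert (m + 1) (range m)) = numCompletions r i (range (m + 2))
      + numCompletions r i (insert (m + 2) (insert (m + 1) (range m))) := by
  have hc : (insert (m + 1) (range m)).card = m + 1 := by
    rw [card_insert_of_notMem (by simp), card_range]
  rw [numCompletions_eq_sum r i _ {m, m + 2}, sum_pair (by omega), insert_insert_range]
  · omega
  · intro x
    rw [hc, sum_range_step, sum_insert (by simp)]
    simp only [mem_singleton, mem_range, mem_insert]
    split_ifs <;> omega

/-- Past place `i` the allowance drops back to at most `1`; only filling in `m` lowers the excess
from `2`, and an ordinary gap remains. -/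
theorem numCompletions_wide_gap (hmr : m + 2 < r) (hi : m + 1 = i) :
    numCompletions r i (insert (m + 2) (range m))
      = numCompletions r i (insert (m + 2) (range (m + 1))) := by
  have hc : (insert (m + 2) (range m)).card = m + 1 := by
    rw [card_insert_of_notMem (by simp), card_range]
  rw [numCompletions_eq_sum r i _ {m}, sum_singleton, insert_comm, ← range_add_one]
  · omega
  · intro x
    rw [hc, sum_range_step, sum_insert (by simp)]
    simp only [mem_singleton, mem_range, mem_insert]
    split_ifs <;> omega

theorem numCompletions_double_gap (hmr : m + 2 < r) (hi : m + 2 = i) :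
    numCompletions r i (insert (m + 2) (insert (m + 1) (range m)))
      = numCompletions r i (range (m + 3)) := by
  have hc : (insert (m + 2) (insert (m + 1) (range m))).card = m + 2 := by
    rw [card_insert_of_notMem (by simp), card_insert_of_notMem (by simp), card_range]
  rw [numCompletions_eq_sum r i _ {m}, sum_singleton]
  · congr 1; ext; simp; omega
  · omega
  · intro x
    rw [hc, sum_range_step, sum_range_step, sum_insert (by simp), sum_insert (by simp)]
    simp only [mem_singleton, mem_range, mem_insert]
    split_ifs <;> omega

end Steps

/-! ### Fibonacci counts of the completions -/

/-- Beyond the place `i < r` the completions are counted by Fibonacci numbers. -/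
theorem numCompletions_range_of_le (i d : ℕ) : ∀ m r, 1 ≤ m → i ≤ m → i < r → m + d = r →
    numCompletions r i (range m) = Nat.fib (d + 1) := by
  induction d using Nat.twoStepInduction with
  | zero =>
    rintro m r hm - - rfl
    simpa using numCompletions_range_top hm
  | one =>
    rintro m r hm him - rfl
    rw [numCompletions_range_pred_top hm rfl (by omega), numCompletions_range_top (by omega)]
    rfl
  | more d ih1 ih2 =>
    intro m r hm him hir h
    rw [numCompletions_range hm (by omega) (by omega), numCompletions_gap (by omega) (by omega),
      ih2 (m + 1) r (by omega) (by omega) hir (by omega),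
      ih1 (m + 2) r (by omega) (by omega) hir (by omega),
      Nat.fib_add_two (n := d + 1), add_comm]

theorem numCompletions_range_last (d : ℕ) : ∀ m r, 1 ≤ m → m + d = r →
    numCompletions r r (range m) = Nat.fib (d + 2) := by
  induction d using Nat.twoStepInduction with
  | zero =>
    rintro m r hm rfl
    simpa using numCompletions_range_top hm
  | one =>
    rintro m r hm rfl
    rw [numCompletions_range_pred_top_of_eq hm rfl rfl, numCompletions_gap le_rfl (by omega),
      numCompletions_range_top (by omega), numCompletions_range_self]
    rfl
  | more d ih1 ih2 =>
    intro m r hm h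
    rw [numCompletions_range hm (by omega) (by omega), numCompletions_gap (by omega) (by omega),
      ih2 (m + 1) r (by omega) (by omega), ih1 (m + 2) r (by omega) (by omega),
      Nat.fib_add_two (n := d + 2), add_comm]

theorem numCompletions_first_or_last (r i : ℕ) (hr : 1 ≤ r) (h : i = 1 ∨ i = r) :
    numCompletions r i ∅ = Nat.fib (r + 1) := by
  rw [← range_zero]
  by_cases hi : i = r
  · subst hi
    obtain ⟨d, rfl⟩ := Nat.exists_eq_add_of_le hr
    rw [numCompletions_range_zero hr (by omega), numCompletions_range_last d 1 _ le_rfl rfl,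
      show d + 2 = 1 + d + 1 by omega]
  · obtain rfl : i = 1 := by omega
    obtain ⟨d, rfl⟩ := Nat.exists_eq_add_of_le (show 2 ≤ r by omega)
    rw [numCompletions_range_zero_one (by omega), numCompletions_gap (by omega) (by omega),
      numCompletions_range_of_le 1 (d + 1) 1 _ le_rfl le_rfl (by omega) (by omega),
      numCompletions_range_of_le 1 d 2 _ (by omega) (by omega) (by omega) rfl,
      show 2 + d + 1 = d + 1 + 2 by omega, Nat.fib_add_two (n := d + 1), add_comm]

theorem numCompletions_range_before (p q r : ℕ) (hr : r = p + q + 3) :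
    numCompletions r (p + 2) (range (p + 1))
      = Nat.fib (q + 2) + Nat.fib (q + 1) + Nat.fib q := by
  subst hr
  have h1 := numCompletions_range_of_le (p + 2) (q + 1) (p + 2) (p + q + 3) (by omega) (by omega)
    (by omega) (by omega)
  have h2 := numCompletions_range_of_le (p + 2) q (p + 3) (p + q + 3) (by omega) (by omega)
    (by omega) (by omega)
  cases q with
  -- Here skipping two values would use `r`, which is not allowed; this matches the vanishing term
  -- `Nat.fib 0`.
  | zero =>
    rw [numCompletions_range_special_top (by omega) rfl rfl, numCompletions_gap (by omega) (by omega), h1,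
      h2]
    rfl
  | succ q =>
    have h3 := numCompletions_range_of_le (p + 2) q (p + 4) (p + (q + 1) + 3) (by omega) (by omega)
      (by omega) (by omega)
    rw [numCompletions_range_special (by omega) (by omega) rfl,
      numCompletions_wide_gap (by omega) rfl, numCompletions_gap (by omega) (by omega),
      numCompletions_gap (by omega) (by omega), h1, h2, h3, ← add_assoc]

theorem numCompletions_gap_before (p q r : ℕ) (hr : r = p + q + 3) (hp : 1 ≤ p) :
    numCompletions r (p + 2) (insert (p + 1) (range p))
      = Nat.fib (q + 2) + Nat.fib (q + 1) := by
  subst hr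
  rw [numCompletions_gap_special hp (by omega) rfl, numCompletions_double_gap (by omega) rfl,
    numCompletions_range_of_le (p + 2) (q + 1) (p + 2) (p + q + 3) (by omega) (by omega)
    (by omega) (by omega), numCompletions_range_of_le (p + 2) q (p + 3) (p + q + 3) (by omega)
    (by omega) (by omega) (by omega)]

/-- A path from `range m` arrives at size `i - 1` either as an interval, in `Nat.fib (d + 1)` ways,
or with a gap, in `Nat.fib d` ways; the other factors count the continuations. -/
theorem numCompletions_range_of_lt (d q : ℕ) : ∀ m r i, 1 ≤ m → m + d + 1 = i → i + q + 1 = r →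
    numCompletions r i (range m)
      = Nat.fib (d + 1) * (Nat.fib (q + 2) + Nat.fib (q + 1) + Nat.fib q)
        + Nat.fib d * (Nat.fib (q + 2) + Nat.fib (q + 1)) := by
  induction d using Nat.twoStepInduction with
  | zero =>
    rintro m r i hm rfl h
    obtain ⟨p, rfl⟩ := Nat.exists_eq_add_of_le' hm
    rw [numCompletions_range_before p q r (by omega)]
    simp
  | one =>
    rintro m r i hm rfl h
    rw [numCompletions_range hm (by omega) (by omega),
      numCompletions_range_before m q r (by omega),
      numCompletions_gap_before m q r (by omega) hm]
    simp
  | more d ih1 ih2 =>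
    intro m r i hm h1 h2
    rw [numCompletions_range hm (by omega) (by omega), numCompletions_gap (by omega) (by omega),
      ih2 (m + 1) r i (by omega) (by omega) h2, ih1 (m + 2) r i (by omega) (by omega) h2,
      Nat.fib_add_two (n := d + 1), Nat.fib_add_two (n := d)]
    ring

theorem numCompletions_interior (r i : ℕ) (hi : 2 ≤ i) (hir : i ≤ r - 1) (hr : 2 < r) :
    numCompletions r i ∅ = Nat.fib r + Nat.fib (i - 1) * Nat.fib (r - i - 1)
      + Nat.fib (i - 2) * Nat.fib (r - i) := by
  obtain ⟨d, rfl⟩ := Nat.exists_eq_add_of_le' hi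
  obtain ⟨q, rfl⟩ := Nat.exists_eq_add_of_le (show d + 2 + 1 ≤ r by omega)
  -- With `d = i - 2` and `q = r - i - 1`, `Nat.fib_add` splits `F_r` as `F_d F_{q+2} + F_{d+1}
  -- F_{q+3}`, the part of the count without the extra products.
  rw [← range_zero, numCompletions_range_zero (by omega) (by omega),
    numCompletions_range_of_lt d q 1 _ _ le_rfl (by omega) (by omega),
    show d + 2 - 1 = d + 1 by omega, show d + 2 + 1 + q - (d + 2) - 1 = q by omega,
    show d + 2 - 2 = d by omega, show d + 2 + 1 + q - (d + 2) = q + 1 by omega,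
    show d + 2 + 1 + q = d + (q + 2) + 1 by omega, Nat.fib_add d (q + 2), Nat.fib_add_two (n := q + 1)]
  ring

/-! ### Coordinates of the roots and of `ρ` -/

section

variable {r : ℕ}

theorem e_apply (r i : ℕ) (k : Fin (r + 1)) : e r i k = if (k : ℕ) + 1 = i then 1 else 0 := rfl

theorem simpleRoot_apply (r i : ℕ) (k : Fin (r + 1)) :
    simpleRoot r i k = (if (k : ℕ) + 1 = i then 1 else 0) - (if (k : ℕ) = i then 1 else 0) := by
  simp [simpleRoot, e_apply]

theorem posRoot_eq (r i j : ℕ) (h : i ≤ j) : posRoot r i j = e r i - e r (j + 1) := by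
  induction j, h using Nat.le_induction with
  | base => simp [posRoot, simpleRoot]
  | succ j h ih =>
    rw [posRoot, sum_Icc_succ_top (by omega), ← posRoot, ih, simpleRoot]
    abel

theorem posRoot_injOn (r : ℕ) : Set.InjOn (fun p : ℕ × ℕ => posRoot r p.1 p.2)
    ((Icc 1 r ×ˢ Icc 1 r).filter (fun p => p.1 ≤ p.2) : Finset (ℕ × ℕ)) := by
  rintro ⟨i, j⟩ hp ⟨i', j'⟩ hp' h
  simp only [coe_filter, mem_product, mem_Icc, Set.mem_ofPred_eq] at hp hp' h
  rw [posRoot_eq _ _ _ hp.2, posRoot_eq _ _ _ hp'.2] at h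
  have at_i := congrArg (fun v : Space r => v ⟨i - 1, by omega⟩) h
  have at_j := congrArg (fun v : Space r => v ⟨j, by omega⟩) h
  simp only [PiLp.sub_apply, e_apply] at at_i at_j
  have h1 : i = i' := by
    by_contra hne
    split_ifs at at_i <;> first | omega | norm_num at at_i
  have h2 : j = j' := by
    by_contra hne
    split_ifs at at_j <;> first | omega | norm_num at at_j
  rw [h1, h2]

theorem sum_positiveRoots (r : ℕ) (f : Space r → ℝ) :
    ∑ β ∈ positiveRoots r, f β = ∑ i ∈ Icc 1 r, ∑ j ∈ Icc i r, f (posRoot r i j) := by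
  classical
  rw [positiveRoots, sum_image (posRoot_injOn r), sum_filter, sum_product]
  refine sum_congr rfl fun i hi => ?_
  rw [← sum_filter]
  refine sum_congr ?_ fun _ _ => rfl
  ext j
  simp only [mem_filter, mem_Icc] at hi ⊢
  omega

theorem rho_apply (r : ℕ) (k : Fin (r + 1)) : rho r k = r / 2 - k := by
  have hk : (k : ℕ) ≤ r := Nat.lt_succ_iff.1 k.2
  have h1 : ∑ i ∈ Icc 1 r, ∑ j ∈ Icc i r, e r i k = (r : ℝ) - k := by
    simp only [e_apply, sum_const, Nat.card_Icc, smul_ite, nsmul_eq_mul, mul_one, smul_zero,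
      sum_ite_eq, mem_Icc]
    split_ifs with h
    · rw [Nat.cast_sub (by omega)]; push_cast; ring
    · have : (k : ℕ) = r := by omega
      simp [this]
  have h2 : ∑ i ∈ Icc 1 r, ∑ j ∈ Icc i r, e r (j + 1) k = (k : ℝ) := by
    -- Summing over `i` first, the `k` roots ending in `-e_{k+1}` are counted.
    rw [sum_comm' (t' := Icc 1 r) (s' := fun j => Icc 1 j) (by
      intro i j; simp only [mem_Icc]; omega)]
    simp only [e_apply, add_left_inj, sum_const, Nat.card_Icc, smul_ite, nsmul_eq_mul, mul_one,
      smul_zero, sum_ite_eq, mem_Icc, add_tsub_cancel_right]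
    split_ifs with h
    · rfl
    · have : (k : ℕ) = 0 := by omega
      simp [this]
  have h3 : (∑ β ∈ positiveRoots r, β) k = ∑ β ∈ positiveRoots r, β k := by
    simp
  have h4 : ∑ i ∈ Icc 1 r, ∑ j ∈ Icc i r, posRoot r i j k = (r : ℝ) - k - k := by
    rw [← h1, ← h2, ← sum_sub_distrib]
    refine sum_congr rfl fun i _ => ?_
    rw [← sum_sub_distrib]
    refine sum_congr rfl fun j hj => ?_
    rw [posRoot_eq _ _ _ (mem_Icc.1 hj).1, PiLp.sub_apply]
  rw [rho, PiLp.smul_apply, h3, sum_positiveRoots r (fun β => β k), h4, smul_eq_mul]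
  ring

theorem highestRoot_apply (r : ℕ) (hr : 1 ≤ r) (k : Fin (r + 1)) :
    highestRoot r k = (if (k : ℕ) = 0 then 1 else 0) - (if (k : ℕ) = r then 1 else 0) := by
  rw [highestRoot, ← posRoot, posRoot_eq _ _ _ hr, PiLp.sub_apply]
  simp [e_apply]

/-! ### Partial sums and positivity of Kostant's partition function -/

/-- The sum of the first `m` coordinates. -/
def prefixSum (m : ℕ) (x : Space r) : ℝ := ∑ k ∈ univ.filter (fun k : Fin (r + 1) => (k : ℕ) < m), x k

theorem prefixSum_zero_left (x : Space r) : prefixSum 0 x = 0 := by simp [prefixSum]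

theorem prefixSum_add (m : ℕ) (x y : Space r) :
    prefixSum m (x + y) = prefixSum m x + prefixSum m y := by
  simp [prefixSum, sum_add_distrib]

theorem prefixSum_sub (m : ℕ) (x y : Space r) :
    prefixSum m (x - y) = prefixSum m x - prefixSum m y := by
  simp [prefixSum, sum_sub_distrib]

theorem prefixSum_neg (m : ℕ) (x : Space r) : prefixSum m (-x) = -prefixSum m x := by
  simp [prefixSum]

theorem prefixSum_succ (x : Space r) (k : Fin (r + 1)) :
    prefixSum (k + 1) x = prefixSum k x + x k := by
  have : (univ.filter fun j : Fin (r + 1) => (j : ℕ) < k + 1)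
      = insert k (univ.filter fun j : Fin (r + 1) => (j : ℕ) < k) := by
    ext j; simp [Fin.ext_iff]; omega
  rw [prefixSum, this, sum_insert (by simp), add_comm, prefixSum]

theorem prefixSum_e (m i : ℕ) (h1 : 1 ≤ i) (h2 : i ≤ r + 1) :
    prefixSum m (e r i) = if i ≤ m then 1 else 0 := by
  have key : ∀ k : Fin (r + 1), ((k : ℕ) + 1 = i) ↔ k = ⟨i - 1, by omega⟩ := by
    intro k; rw [Fin.ext_iff]; simp only; omega
  simp only [prefixSum, e_apply, key, sum_ite_eq', mem_filter, mem_univ, true_and]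
  exact if_congr (by omega) rfl rfl

theorem prefixSum_simpleRoot (m i : ℕ) (h1 : 1 ≤ i) (h2 : i ≤ r) :
    prefixSum m (simpleRoot r i) = if m = i then 1 else 0 := by
  rw [simpleRoot, prefixSum_sub, prefixSum_e _ _ h1 (by omega), prefixSum_e _ _ (by omega) (by omega)]
  split_ifs <;> first | omega | norm_num

/-- Abel summation; the partial sums at `0` and `r + 1` vanish, so the boundary terms drop out. -/
theorem sum_prefixSum_smul_simpleRoot (x : Space r) (hx : prefixSum (r + 1) x = 0) :
    ∑ j ∈ Icc 1 r, prefixSum j x • simpleRoot r j = x := by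
  ext k
  have hk : (k : ℕ) ≤ r := Nat.lt_succ_iff.1 k.2
  have h1 : (if (k : ℕ) + 1 ∈ Icc 1 r then prefixSum (k + 1) x else 0) = prefixSum (k + 1) x := by
    split_ifs with h
    · rfl
    · rw [show (k : ℕ) = r by rw [mem_Icc] at h; omega, hx]
  have h2 : (if (k : ℕ) ∈ Icc 1 r then prefixSum k x else 0) = prefixSum k x := by
    split_ifs with h
    · rfl
    · rw [show (k : ℕ) = 0 by rw [mem_Icc] at h; omega, prefixSum_zero_left]
  simp only [WithLp.ofLp_sum, Finset.sum_apply, PiLp.smul_apply, simpleRoot_apply, smul_eq_mul,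
    mul_sub, mul_ite, mul_one, mul_zero, sum_sub_distrib, sum_ite_eq]
  rw [h1, h2, prefixSum_succ]
  ring

theorem kostantPartition_pos_iff_nonempty (ξ : Space r) :
    0 < kostantPartition r ξ ↔ (partitions r ξ).Nonempty :=
  Set.ncard_pos (partitions_finite r ξ)

theorem partitions_nonempty_add {ξ η : Space r} (hξ : (partitions r ξ).Nonempty)
    (hη : (partitions r η).Nonempty) : (partitions r (ξ + η)).Nonempty := by
  obtain ⟨c, rfl⟩ := hξ
  obtain ⟨d, rfl⟩ := hη
  exact ⟨c + d, by simp [partitions, add_smul, sum_add_distrib]⟩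

theorem partitions_nonempty_zero : (partitions r 0).Nonempty := ⟨0, by simp [partitions]⟩

theorem partitions_nonempty_positiveRoot {β : Space r} (hβ : β ∈ positiveRoots r) :
    (partitions r β).Nonempty := by
  classical
  refine ⟨Pi.single ⟨β, hβ⟩ 1, ?_⟩
  rw [partitions, Set.mem_ofPred_eq, sum_eq_single ⟨β, hβ⟩]
  · simp
  · intro γ _ hγ; simp [hγ]
  · simp

theorem simpleRoot_mem_positiveRoots {j : ℕ} (hj : j ∈ Icc 1 r) :
    simpleRoot r j ∈ positiveRoots r := by
  classical
  rw [positiveRoots, mem_image]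
  exact ⟨(j, j), by simpa using hj, by simp [posRoot]⟩

/-- Kostant's partition function is positive exactly on the vectors with coordinate sum zero whose
partial coordinate sums are natural numbers. -/
theorem kostantPartition_pos_iff (ξ : Space r) :
    0 < kostantPartition r ξ ↔
      prefixSum (r + 1) ξ = 0 ∧ ∀ m ≤ r, ∃ n : ℕ, prefixSum m ξ = n := by
  rw [kostantPartition_pos_iff_nonempty]
  constructor
  · rintro ⟨c, rfl⟩
    have key : ∀ β ∈ positiveRoots r,
        prefixSum (r + 1) β = 0 ∧ ∀ m ≤ r, ∃ n : ℕ, prefixSum m β = n := by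
      classical
      intro β hβ
      simp only [positiveRoots, mem_image, mem_filter, mem_product, mem_Icc] at hβ
      obtain ⟨⟨i, j⟩, ⟨⟨⟨hi, _⟩, ⟨_, hj⟩⟩, hij⟩, rfl⟩ := hβ
      simp only at hi hj hij ⊢
      simp only [posRoot_eq _ _ _ hij, prefixSum_sub, prefixSum_e (r := r) _ i hi (hij.trans (by omega)),
        prefixSum_e (r := r) _ (j + 1) (Nat.le_add_left 1 j) (Nat.succ_le_succ hj)]
      refine ⟨by rw [if_pos (by omega), if_pos (by omega), sub_self], fun m _ => ?_⟩
      refine ⟨if i ≤ m ∧ m ≤ j then 1 else 0, ?_⟩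
      split_ifs <;> first | omega | norm_num
    let φ (m : ℕ) : Space r →+ ℝ := AddMonoidHom.mk' (prefixSum m) (prefixSum_add m)
    have hφ (m : ℕ) (x : Space r) : prefixSum m x = φ m x := rfl
    simp only [hφ, map_sum, map_nsmul] at key ⊢
    refine ⟨sum_eq_zero fun β _ => by rw [(key β β.2).1, smul_zero], fun m hm => ?_⟩
    choose n hn using fun β : positiveRoots r => (key β β.2).2 m hm
    exact ⟨∑ β, c β * n β, by simp [hn]⟩
  · rintro ⟨h0, h⟩
    -- Simple roots alone already give a partition.
    rw [← sum_prefixSum_smul_simpleRoot ξ h0]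
    refine sum_induction _ (fun η => (partitions r η).Nonempty)
      (fun _ _ => partitions_nonempty_add) partitions_nonempty_zero fun j hj => ?_
    obtain ⟨n, hn⟩ := h j (mem_Icc.1 hj).2
    rw [hn, Nat.cast_smul_eq_nsmul]
    clear hn
    induction n with
    | zero => simpa using partitions_nonempty_zero
    | succ n ih =>
      rw [succ_nsmul]
      exact partitions_nonempty_add ih
        (partitions_nonempty_positiveRoot (simpleRoot_mem_positiveRoots hj))

/-! ### The Weyl group as the symmetric group -/

/-- The action of the symmetric group on `ℝ^{r+1}` by permutations of the coordinates. -/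
noncomputable def permHom (r : ℕ) : Equiv.Perm (Fin (r + 1)) →* (Space r ≃ₗᵢ[ℝ] Space r) where
  toFun τ := LinearIsometryEquiv.piLpCongrLeft 2 ℝ ℝ τ
  map_one' := by ext v k; rfl
  map_mul' σ τ := by ext v k; rfl

theorem permHom_apply (τ : Equiv.Perm (Fin (r + 1))) (v : Space r) (k : Fin (r + 1)) :
    permHom r τ v k = v (τ.symm k) := rfl

theorem permHom_injective (r : ℕ) : Function.Injective (permHom r) := by
  intro σ τ h
  have h' : σ.symm = τ.symm := by
    ext k
    have := congrArg (fun f : Space r ≃ₗᵢ[ℝ] Space r => f (e r (σ.symm k + 1)) k) h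
    simp only [permHom_apply, e_apply, if_true, add_left_inj] at this
    by_contra hne
    rw [if_neg (fun h => hne h.symm)] at this
    exact one_ne_zero this
  exact Equiv.symm_bijective.injective h'

theorem simpleReflection_eq_permHom_swap (j : Fin r) :
    simpleReflection r (j + 1) = permHom r (Equiv.swap j.castSucc j.succ) := by
  have hα : simpleRoot r (j + 1)
      = EuclideanSpace.single j.castSucc (1 : ℝ) - EuclideanSpace.single j.succ (1 : ℝ) := by
    ext k
    simp [simpleRoot_apply, Fin.ext_iff]
  have hne : j.castSucc ≠ j.succ := (Fin.castSucc_lt_succ).ne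
  ext v k
  rw [simpleReflection_apply, permHom_apply, hα, Equiv.symm_swap]
  simp only [inner_sub_left, inner_sub_right, EuclideanSpace.inner_single_left, map_one, one_mul,
    PiLp.sub_apply, PiLp.smul_apply, smul_eq_mul, PiLp.single_apply, Equiv.swap_apply_def]
  split_ifs <;> simp_all <;> ring

theorem weylGroup_eq_range (r : ℕ) : weylGroup r = (permHom r).range := by
  have hS : simpleReflection r '' Set.Icc 1 r
      = permHom r '' Set.range fun j : Fin r => Equiv.swap j.castSucc j.succ := by
    ext f
    simp only [Set.mem_image, Set.mem_Icc, Set.mem_range, exists_exists_eq_and]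
    constructor
    · rintro ⟨i, ⟨h1, h2⟩, rfl⟩
      refine ⟨⟨i - 1, by omega⟩, ?_⟩
      rw [← simpleReflection_eq_permHom_swap]
      congr 1
      simp only; omega
    · rintro ⟨j, rfl⟩
      exact ⟨j + 1, ⟨by omega, by omega⟩, simpleReflection_eq_permHom_swap j⟩
  have hT : Subgroup.closure (Set.range fun j : Fin r => Equiv.swap j.castSucc j.succ) = ⊤ := by
    refine top_unique fun τ _ => ?_
    have : τ ∈ Submonoid.closure (Set.range fun j : Fin r => Equiv.swap j.castSucc j.succ) := by
      rw [Equiv.Perm.mclosure_swap_castSucc_succ]; trivial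
    exact Subgroup.le_closure_toSubmonoid _ this
  rw [weylGroup, hS, ← MonoidHom.map_closure, hT, MonoidHom.range_eq_map]

/-! ### The alternation set in terms of good prefixes -/

/-- The set of the first `m` values of a permutation. -/
def prefixValues (τ : Equiv.Perm (Fin (r + 1))) (m : ℕ) : Finset ℕ :=
  ((List.ofFn fun k => (τ k : ℕ)).take m).toFinset

theorem prefixValues_eq_image (τ : Equiv.Perm (Fin (r + 1))) (m : ℕ) :
    prefixValues τ m = (univ.filter fun k : Fin (r + 1) => (k : ℕ) < m).image
      fun k => (τ k : ℕ) := by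
  ext v
  simp only [prefixValues, List.mem_toFinset, List.mem_take_iff_getElem, List.getElem_ofFn,
    List.length_ofFn, mem_image, mem_filter, mem_univ, true_and]
  constructor
  · rintro ⟨k, hk, rfl⟩
    exact ⟨⟨k, by omega⟩, by simp only; omega, rfl⟩
  · rintro ⟨k, hk, rfl⟩
    exact ⟨k, by omega, rfl⟩

theorem val_comp_injective (τ : Equiv.Perm (Fin (r + 1))) :
    Function.Injective fun k => (τ k : ℕ) := Fin.val_injective.comp τ.injective

theorem sum_prefixValues (τ : Equiv.Perm (Fin (r + 1))) (m : ℕ) (f : ℕ → ℝ) :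
    ∑ v ∈ prefixValues τ m, f v = ∑ k ∈ univ.filter (fun k : Fin (r + 1) => (k : ℕ) < m), f (τ k) := by
  rw [prefixValues_eq_image, sum_image fun _ _ _ _ h => val_comp_injective τ h]

theorem card_prefixValues (τ : Equiv.Perm (Fin (r + 1))) (m : ℕ) (hm : m ≤ r + 1) :
    (prefixValues τ m).card = m := by
  rw [prefixValues, List.toFinset_card_of_nodup
    ((List.nodup_ofFn.2 (val_comp_injective τ)).sublist (List.take_sublist _ _))]
  simpa using hm

theorem sum_val_lt (r m : ℕ) (hm : m ≤ r + 1) :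
    ∑ k ∈ univ.filter (fun k : Fin (r + 1) => (k : ℕ) < m), (k : ℝ) = ∑ k ∈ range m, (k : ℝ) := by
  rw [sum_filter, Fin.sum_univ_eq_sum_range (fun k => if k < m then (k : ℝ) else 0) (r + 1),
    ← sum_filter]
  refine sum_congr ?_ fun _ _ => rfl
  ext k; simp; omega

theorem prefixSum_alternation (i m : ℕ) (hr : 1 ≤ r) (hi : 1 ≤ i) (hir : i ≤ r)
    (hm : m ≤ r + 1) (τ : Equiv.Perm (Fin (r + 1))) :
    prefixSum m (permHom r τ.symm (highestRoot r + rho r) - -simpleRoot r i - rho r)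
      = ((∑ k ∈ range (prefixValues τ m).card, k + (if 0 ∈ prefixValues τ m then 1 else 0)
          + (if (prefixValues τ m).card = i then 1 else 0) : ℕ) : ℝ)
        - ((∑ v ∈ prefixValues τ m, v + (if r ∈ prefixValues τ m then 1 else 0) : ℕ) : ℝ) := by
  have h1 : prefixSum m (permHom r τ.symm (highestRoot r + rho r))
      = ∑ v ∈ prefixValues τ m, ((if v = 0 then 1 else 0) - (if v = r then 1 else 0)
          + ((r : ℝ) / 2 - v)) := by
    rw [sum_prefixValues, prefixSum]
    refine sum_congr rfl fun k _ => ?_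
    rw [permHom_apply, Equiv.symm_symm, PiLp.add_apply, highestRoot_apply r hr, rho_apply]
  have h2 : prefixSum m (rho r) = ∑ v ∈ prefixValues τ m, (r : ℝ) / 2 - ∑ k ∈ range m, (k : ℝ) := by
    rw [sum_prefixValues, prefixSum, ← sum_val_lt r m hm, ← sum_sub_distrib]
    exact sum_congr rfl fun k _ => rho_apply r k
  rw [prefixSum_sub, prefixSum_sub, prefixSum_neg, prefixSum_simpleRoot _ _ hi hir, h1, h2,
    card_prefixValues _ _ hm]
  simp only [sum_add_distrib, sum_sub_distrib, sum_ite_eq']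
  push_cast
  ring

theorem exists_natCast_eq_sub_iff (a b : ℕ) : (∃ n : ℕ, (a : ℝ) - b = n) ↔ b ≤ a := by
  constructor
  · rintro ⟨n, hn⟩
    have : (b : ℝ) ≤ a := by linarith [n.cast_nonneg (α := ℝ)]
    exact_mod_cast this
  · exact fun h => ⟨a - b, (Nat.cast_sub h).symm⟩

theorem prefixValues_full (τ : Equiv.Perm (Fin (r + 1))) :
    prefixValues τ (r + 1) = range (r + 1) := by
  refine eq_of_subset_of_card_le ?_ (by rw [card_prefixValues _ _ le_rfl, card_range])
  rw [prefixValues_eq_image]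
  intro v hv
  obtain ⟨k, _, rfl⟩ := mem_image.1 hv
  exact mem_range.2 (τ k).2

theorem alternation_iff (i : ℕ) (hr : 1 ≤ r) (hi : 1 ≤ i) (hir : i ≤ r)
    (τ : Equiv.Perm (Fin (r + 1))) :
    0 < kostantPartition r
        (permHom r τ.symm (highestRoot r + rho r) - -simpleRoot r i - rho r) ↔
      ∀ m < r + 1, GoodPrefix r i (prefixValues τ (m + 1)) := by
  rw [kostantPartition_pos_iff]
  have hfull := prefixSum_alternation i (r + 1) hr hi hir le_rfl τ
  rw [prefixValues_full] at hfull
  have hpre (m : ℕ) (hm : m ≤ r + 1) : (∃ n : ℕ, prefixSum m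
      (permHom r τ.symm (highestRoot r + rho r) - -simpleRoot r i - rho r) = n) ↔
        GoodPrefix r i (prefixValues τ m) := by
    rw [prefixSum_alternation i m hr hi hir hm τ, exists_natCast_eq_sub_iff, GoodPrefix]
  constructor
  · rintro ⟨h0, h⟩ m hm
    rw [← hpre _ (by omega)]
    rcases Nat.lt_or_ge m r with hmr | hmr
    · exact h _ hmr
    · rw [show m = r by omega, h0]
      exact ⟨0, by simp⟩
  · refine fun h => ⟨?_, fun m hm => ?_⟩
    -- The full set contains both `0` and `r`, whose contributions cancel, and its size `r + 1`
    -- misses the bonus.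
    · rw [hfull]
      simp [show r + 1 ≠ i by omega]
    · cases m with
      | zero => exact ⟨0, by simp [prefixSum_zero_left]⟩
      | succ m => exact (hpre _ (by omega)).2 (h m (by omega))

theorem ncard_weylAlternationSet (i : ℕ) (hr : 1 ≤ r) (hi : 1 ≤ i) (hir : i ≤ r) :
    (weylAlternationSet r (highestRoot r) (-simpleRoot r i)).ncard = numCompletions r i ∅ := by
  rw [numCompletions, card_empty, Nat.sub_zero, ← ncard_perm_eq_card_completions]
  symm
  refine Set.ncard_congr (fun τ _ => ⟨permHom r τ.symm, weylGroup_eq_range r ▸ ⟨_, rfl⟩⟩) ?_ ?_ ?_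
  · exact fun τ hτ => (alternation_iff i hr hi hir τ).2 hτ
  · intro σ τ _ _ h
    exact Equiv.symm_bijective.injective (permHom_injective r (congrArg Subtype.val h))
  · rintro ⟨f, hf⟩ h
    obtain ⟨τ, rfl⟩ := weylGroup_eq_range r ▸ hf
    exact ⟨τ.symm, (alternation_iff i hr hi hir τ.symm).1 h, rfl⟩

end

end TypeA

theorem mainTheorem9 (r i : ℕ) (hr : 1 ≤ r) (hi : 1 ≤ i) (hir : i ≤ r) :
    ((i = 1 ∨ i = r) →
      (TypeA.weylAlternationSet r (TypeA.highestRoot r) (-TypeA.simpleRoot r i)).ncard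
        = Nat.fib (r + 1)) ∧
    (2 < r → 2 ≤ i → i ≤ r - 1 →
      (TypeA.weylAlternationSet r (TypeA.highestRoot r) (-TypeA.simpleRoot r i)).ncard
        = Nat.fib r + Nat.fib (i - 1) * Nat.fib (r - i - 1)
          + Nat.fib (i - 2) * Nat.fib (r - i)) := by
  rw [TypeA.ncard_weylAlternationSet i hr hi hir]
  exact ⟨TypeA.numCompletions_first_or_last r i hr,
    fun hr2 hi2 hir2 => TypeA.numCompletions_interior r i hi2 hir2 hr2⟩
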